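/- **Theorem 2.** Let $G(s)=R(s)e^{-\tau s}$ be the open-loop transfer function of a linear feedback loop, where $R$ is a rational function with real coefficients (of any relative degree) and $\tau\ge 0$ is a dead time, and let $g=\dfrac{1}{1+G}$ be its sensitivity function, regarded as a meromorphic function. Suppose that, in the open right half-plane, $g$ has exactly the zeros $\alpha_1,\dots,\alpha_M$ and the poles $\beta_1,\dots,\beta_N$, repeated according to multiplicity ($M,N\ge 0$ finite). Let $\omega_c\ge 0$ and suppose that $$\rho=\max_{0\le\omega\le\omega_c}|g(j\omega)|\in[0,1),\qquad s_{\max}=\sup_{\omega>\omega_c}|g(j\omega)|\in(1,\infty).$$ For real $\sigma>0$ different from all $\alpha_i$ and $\beta_i$ put $$B(\sigma)=\sum_{i=1}^{M}\log\left|\frac{\sigma-\alpha_i}{\sigma+\bar\alpha_i}\right|+\sum_{i=1}^{N}\log\left|\frac{\sigma+\bar\beta_i}{\sigma-\beta_i}\right|.$$ (a) If $\sigma_k>0$ is real, different from all $\alpha_i$ and $\beta_i$, and $-\log|g(\sigma_k)|+B(\sigma_k)\le 0$, then $$\log s_{\max}\ \ge\ \frac{\left|\frac{\pi}{2}\bigl(-\log|g(\sigma_k)|+B(\sigma_k)\bigr)+\arctan\frac{\omega_c}{\sigma_k}\,\log\rho\right|}{\frac{\pi}{2}-\arctan\frac{\omega_c}{\sigma_k}}.$$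 (b) If $\sigma_k>0$ is a real zero of $G$ (a real nonminimum phase open-loop zero) and $B(\sigma_k)\le 0$, then $$\log s_{\max}\ \ge\ \frac{\left|\frac{\pi}{2}\,B(\sigma_k)+\arctan\frac{\omega_c}{\sigma_k}\,\log\rho\right|}{\frac{\pi}{2}-\arctan\frac{\omega_c}{\sigma_k}}.$$ (If $\omega_c=0$, the term $\arctan(\omega_c/\sigma_k)\log\rho$ is read as $0$, also when $\rho=0$.) -/

import Mathlib

open Complex ComplexConjugate

noncomputable section

/-- The forward-path (open-loop) transfer function `G(s) = R(s) e^{-τ s}`: a real rational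
function `R` of any relative degree, in lowest terms, and a dead time `τ`. At poles of `R` the
value is the junk value `0`. -/
def openLoop (R : RatFunc ℝ) (τ : ℝ) (s : ℂ) : ℂ :=
  Polynomial.aeval s R.num / Polynomial.aeval s R.denom * exp (-(τ * s))

/-- The sensitivity function `g = 1 / (1 + G)`, written with the denominator of `R` cleared, so
that it has its correct value `0` at the poles of `G`. At poles of `g` the value is the junk
value `0`. -/
def sensitivity (R : RatFunc ℝ) (τ : ℝ) (s : ℂ) : ℂ :=
  Polynomial.aeval s R.denom /
    (Polynomial.aeval s R.denom + Polynomial.aeval s R.num * exp (-(τ * s)))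

/-- Away from the poles of `G`, the function `sensitivity` is literally `1 / (1 + G)`. -/
theorem sensitivity_eq (R : RatFunc ℝ) (τ : ℝ) (s : ℂ)
    (hs : Polynomial.aeval s R.denom ≠ 0) :
    sensitivity R τ s = 1 / (1 + openLoop R τ s) := by
  unfold sensitivity openLoop
  rw [show 1 + Polynomial.aeval s R.num / Polynomial.aeval s R.denom * exp (-(τ * s)) =
    (Polynomial.aeval s R.denom + Polynomial.aeval s R.num * exp (-(τ * s))) /
      Polynomial.aeval s R.denom by field_simp, one_div_div]

/-- `ζ` is a nonminimum phase open-loop zero: a zero of `G` in the open right half-plane. Since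
`R.num` and `R.denom` are coprime and the exponential has no zeros, the zeros of `G` are the
roots of `R.num`. -/
def IsNMPOpenLoopZero (R : RatFunc ℝ) (ζ : ℂ) : Prop :=
  0 < ζ.re ∧ Polynomial.aeval ζ R.num = 0

/-- `α` lists the zeros and `β` the poles of `g` in the open right half-plane, each repeated
according to its multiplicity. -/
def IsRHPZeroPoleList (g : ℂ → ℂ) {M N : ℕ} (α : Fin M → ℂ) (β : Fin N → ℂ) : Prop :=
  (∀ i, 0 < (α i).re) ∧ (∀ j, 0 < (β j).re) ∧ (∀ i j, α i ≠ β j) ∧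
    ∀ z : ℂ, 0 < z.re → meromorphicOrderAt g z =
      (((Nat.card {i // α i = z} : ℤ) - (Nat.card {j // β j = z} : ℤ) : ℤ) : WithTop ℤ)

/-- The Blaschke terms `∑ log |(σ - αᵢ) / (σ + ᾱᵢ)| + ∑ log |(σ + β̄ᵢ) / (σ - βᵢ)|`. -/
def blaschkeTerms {M N : ℕ} (α : Fin M → ℂ) (β : Fin N → ℂ) (σ : ℝ) : ℝ :=
  ∑ i, Real.log ‖((σ : ℂ) - α i) / ((σ : ℂ) + conj (α i))‖ +
    ∑ j, Real.log ‖((σ : ℂ) + conj (β j)) / ((σ : ℂ) - β j)‖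

end

/-!
Write `g = D / F` with `D` the denominator of `R` and `F` the closed-loop characteristic function.
Dividing the zeros and poles of `g` in the right half-plane out by Blaschke factors leaves a
zero-free `h` with `|h| = |g|` on the imaginary axis and `log |h(σ)| = log |g(σ)| - B(σ)`. The
harmonic function `log |h|` is compared with the one whose boundary value is `log ρ` on the segment
`[-iω_c, iω_c]` and `log s_max` off it: up to the factor `π`, the harmonic measure of the segment
seen from `σ` is the angle `2 arctan (ω_c / σ)` which it subtends there. Phragmén–Lindelöf needs
`log |h|` to grow at most linearly; this holds because `h` is a quotient of zero-free functions of
polynomial growth, so that `log |h|` has a positive harmonic majorant and the Poisson kernel at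
infinity is `Re s`.
-/

section

open Filter Topology Asymptotics Metric

theorem harmonic_le_mul_of_poissonKernel_mul_le {φ V : ℂ → ℝ} {c w : ℂ} {R K : ℝ}
    (hφ : InnerProductSpace.HarmonicOnNhd φ (closedBall c R))
    (hV : InnerProductSpace.HarmonicOnNhd V (closedBall c R)) (hw : w ∈ ball c R)
    (h : ∀ ζ ∈ sphere c R, poissonKernel c w ζ * φ ζ ≤ K * V ζ) : φ w ≤ K * V c := by
  have hR : |R| = R := abs_of_pos (dist_nonneg.trans_lt hw)
  have hP : ContinuousOn (poissonKernel c w) (sphere c |R|) := by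
    rw [poissonKernel_eq_re_herglotzRieszKernel]
    exact continuous_re.comp_continuousOn (continuousOn_herglotzRieszKernel_sphere hw)
  have hsub : sphere c |R| ⊆ closedBall c R := by
    rw [hR]
    exact sphere_subset_closedBall
  calc φ w = Real.circleAverage (poissonKernel c w • φ) c R :=
        (hφ.circleAverage_poissonKernel_smul hw).symm
    _ ≤ Real.circleAverage (K • V) c R :=
        Real.circleAverage_mono (hP.smul (hφ.continuousOn.mono hsub)).circleIntegrable'
          ((hV.continuousOn.mono hsub).const_smul K).circleIntegrable'
          fun ζ hζ => h ζ (hR ▸ hζ)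
    _ = K * V c := by
        rw [Real.circleAverage_smul,
          InnerProductSpace.HarmonicOnNhd.circleAverage_eq (by rwa [hR]), smul_eq_mul]

theorem poissonKernel_nonneg {c w z : ℂ} (h : ‖w - c‖ ≤ ‖z - c‖) : 0 ≤ poissonKernel c w z :=
  div_nonneg (sub_nonneg.2 (by gcongr)) (sq_nonneg _)

theorem poissonKernel_le_of_norm_sub_lt {p z ζ : ℂ} (hz : ‖z‖ ≤ 1) (hζ : ‖ζ‖ ≤ 1)
    (h : ‖ζ - p‖ < ‖p - z‖ / 2) :
    poissonKernel 0 z ζ ≤ 4 * ((1 - ‖z‖ ^ 2) / ‖p - z‖ ^ 2) := by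
  have hpz : 0 < ‖p - z‖ := by linarith [norm_nonneg (ζ - p)]
  have hfar : ‖p - z‖ / 2 ≤ ‖ζ - z‖ := by
    have := norm_sub_le_norm_sub_add_norm_sub p ζ z
    rw [norm_sub_rev p ζ] at this
    linarith
  calc poissonKernel 0 z ζ = (‖ζ‖ ^ 2 - ‖z‖ ^ 2) / ‖ζ - z‖ ^ 2 := by
        simp only [poissonKernel_def, sub_zero]
    _ ≤ (1 - ‖z‖ ^ 2) / (‖p - z‖ / 2) ^ 2 := by
        gcongr
        · exact sub_nonneg.2 (pow_le_one₀ (norm_nonneg z) hz)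
        · exact pow_le_one₀ (norm_nonneg ζ) hζ
    _ = 4 * ((1 - ‖z‖ ^ 2) / ‖p - z‖ ^ 2) := by field_simp; norm_num

-- Near `p` the Poisson kernel of `z` is bounded and `φ ≤ V`; away from `p`, `φ` is almost `≤ 0`.
theorem harmonic_le_of_majorant_of_boundary {φ V : ℂ → ℝ} {p z : ℂ} (hp : ‖p‖ = 1)
    (hφ : InnerProductSpace.HarmonicOnNhd φ (ball 0 1))
    (hV : InnerProductSpace.HarmonicOnNhd V (ball 0 1))
    (hV0 : ∀ ζ ∈ ball (0 : ℂ) 1, 0 ≤ V ζ) (hφV : ∀ ζ ∈ ball (0 : ℂ) 1, φ ζ ≤ V ζ)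
    (hbd : ∀ η > 0, ∀ δ > 0,
      ∀ᶠ r in 𝓝[<] (1 : ℝ), ∀ ζ ∈ sphere (0 : ℂ) r, δ ≤ ‖ζ - p‖ → φ ζ ≤ η)
    (hz : ‖z‖ < 1) : φ z ≤ 4 * ((1 - ‖z‖ ^ 2) / ‖p - z‖ ^ 2) * V 0 := by
  have hpz : 0 < ‖p - z‖ := norm_pos_iff.2 (sub_ne_zero.2 (by rintro rfl; exact hz.ne hp))
  refine le_of_forall_pos_le_add fun η hη => ?_
  obtain ⟨r, hr, hzr, hr1⟩ :=
    ((hbd η hη (‖p - z‖ / 2) (by positivity)).and (Ioo_mem_nhdsLT hz)).exists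
  have hsub : closedBall (0 : ℂ) r ⊆ ball 0 1 := closedBall_subset_ball hr1
  rw [← sub_le_iff_le_add]
  refine harmonic_le_mul_of_poissonKernel_mul_le (φ := fun ζ => φ ζ - η) (R := r)
    ((hφ.mono hsub).sub (InnerProductSpace.harmonicOnNhd_const η)) (hV.mono hsub)
    (mem_ball_zero_iff.2 hzr) fun ζ hζ => ?_
  have hζr : ‖ζ‖ = r := mem_sphere_zero_iff_norm.1 hζ
  have hζ1 : ζ ∈ ball (0 : ℂ) 1 := hsub (sphere_subset_closedBall hζ)
  have hP0 : 0 ≤ poissonKernel 0 z ζ := poissonKernel_nonneg (by simpa [hζr] using hzr.le)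
  have hK0 : 0 ≤ 4 * ((1 - ‖z‖ ^ 2) / ‖p - z‖ ^ 2) := mul_nonneg zero_le_four
    (div_nonneg (sub_nonneg.2 (pow_le_one₀ (norm_nonneg z) hz.le)) (sq_nonneg _))
  rcases le_or_gt (‖p - z‖ / 2) ‖ζ - p‖ with hfar | hnear
  · calc poissonKernel 0 z ζ * (φ ζ - η) ≤ 0 :=
          mul_nonpos_of_nonneg_of_nonpos hP0 (sub_nonpos.2 (hr ζ hζ hfar))
      _ ≤ _ := mul_nonneg hK0 (hV0 ζ hζ1)
  · calc poissonKernel 0 z ζ * (φ ζ - η) ≤ poissonKernel 0 z ζ * V ζ :=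
          mul_le_mul_of_nonneg_left (by linarith [hφV ζ hζ1]) hP0
      _ ≤ _ := mul_le_mul_of_nonneg_right
          (poissonKernel_le_of_norm_sub_lt hz.le (hζr.le.trans hr1.le) hnear) (hV0 ζ hζ1)

theorem eventually_forall_norm_eq_lt_of_isCompact {E : Type*} [SeminormedAddGroup E] {K : Set E}
    {G : E → ℝ} {a b : ℝ} (hK : IsCompact K) (hG : ContinuousOn G K)
    (h : ∀ ζ ∈ K, ‖ζ‖ = a → G ζ < b) : ∀ᶠ r in 𝓝 a, ∀ ζ ∈ K, ‖ζ‖ = r → G ζ < b := by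
  obtain ⟨U, hU, hGU⟩ := continuousOn_iff_isClosed.1 hG (Set.Ici b) isClosed_Ici
  have hclosed : IsClosed (norm '' (K ∩ G ⁻¹' Set.Ici b)) := by
    rw [Set.inter_comm, hGU, Set.inter_comm]
    exact ((hK.inter_right hU).image continuous_norm).isClosed
  have ha : a ∉ norm '' (K ∩ G ⁻¹' Set.Ici b) := by
    rintro ⟨ζ, ⟨hζ, hb⟩, rfl⟩
    exact (h ζ hζ rfl).not_ge hb
  filter_upwards [hclosed.isOpen_compl.mem_nhds ha] with r hr ζ hζ hζr
  exact not_le.1 fun hb => hr ⟨ζ, ⟨hζ, hb⟩, hζr⟩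

/-- The Cayley transform, carrying the unit disc to the right half-plane and the point `1` to
infinity; at `1` its value is the junk value `0`. -/
noncomputable def cayley (z : ℂ) : ℂ := (1 + z) / (1 - z)

theorem cayley_re (z : ℂ) : (cayley z).re = (1 - ‖z‖ ^ 2) / ‖1 - z‖ ^ 2 := by
  simpa [cayley, poissonKernel_def, herglotzRieszKernel_def] using
    (congrFun (poissonKernel_eq_re_herglotzRieszKernel (c := 0) (w := z)) 1).symm

theorem cayley_re_nonneg {z : ℂ} (hz : ‖z‖ ≤ 1) : 0 ≤ (cayley z).re :=
  cayley_re z ▸ div_nonneg (sub_nonneg.2 (pow_le_one₀ (norm_nonneg z) hz)) (sq_nonneg _)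

theorem cayley_re_pos_iff {z : ℂ} : 0 < (cayley z).re ↔ ‖z‖ < 1 := by
  rcases eq_or_ne z 1 with rfl | hz
  · simp [cayley]
  · have h1z : 0 < ‖1 - z‖ := norm_pos_iff.2 (sub_ne_zero.2 hz.symm)
    rw [cayley_re, div_pos_iff_of_pos_right (by positivity), sub_pos,
      sq_lt_one_iff₀ (norm_nonneg z)]

theorem analyticAt_cayley {z : ℂ} (hz : z ≠ 1) : AnalyticAt ℂ cayley z := by
  have h1z : 1 - z ≠ 0 := sub_ne_zero.2 hz.symm
  unfold cayley
  fun_prop (disch := assumption)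

theorem cayley_sub_one_div_add_one {s : ℂ} (hs : s ≠ -1) : cayley ((s - 1) / (s + 1)) = s := by
  have h1 : s + 1 ≠ 0 := by rwa [Ne, add_eq_zero_iff_eq_neg]
  rw [cayley, one_add_div h1, one_sub_div h1]
  field_simp
  ring

theorem isOpen_re_pos : IsOpen {s : ℂ | 0 < s.re} := isOpen_lt continuous_const continuous_re

/-- Zero-free functions of bounded type on the right half-plane, continuous up to the imaginary
axis. Bounded type means a quotient of bounded holomorphic functions; as the function has no
zeros, the denominator `b` may be taken to be zero-free too, and both bounds normalised to `1`. -/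
structure IsZeroFreeBoundedType (f : ℂ → ℂ) : Prop where
  diffContOnCl : DiffContOnCl ℂ f {s | 0 < s.re}
  ne_zero : ∀ s, 0 < s.re → f s ≠ 0
  exists_denom : ∃ b : ℂ → ℂ, DifferentiableOn ℂ b {s | 0 < s.re} ∧
    ∀ s, 0 < s.re → b s ≠ 0 ∧ ‖b s‖ ≤ 1 ∧ ‖f s * b s‖ ≤ 1

theorem eventually_log_norm_comp_cayley_le {f : ℂ → ℂ} (hf : ContinuousOn f {s | 0 ≤ s.re})
    (hf0 : ∀ s, 0 < s.re → f s ≠ 0) (hf1 : ∀ s, s.re = 0 → ‖f s‖ ≤ 1) {η δ : ℝ} (hη : 0 < η)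
    (hδ : 0 < δ) : ∀ᶠ r in 𝓝[<] (1 : ℝ), ∀ ζ ∈ sphere (0 : ℂ) r, δ ≤ ‖ζ - 1‖ →
      Real.log ‖f (cayley ζ)‖ ≤ η := by
  let K : Set ℂ := closedBall 0 1 ∩ {ζ | δ ≤ ‖ζ - 1‖}
  have hK : IsCompact K := (isCompact_closedBall 0 1).inter_right
    (isClosed_le continuous_const (by fun_prop))
  have hcont : ContinuousOn (fun ζ => ‖f (cayley ζ)‖) K := by
    refine (hf.comp (fun ζ hζ => ?_) fun ζ hζ =>
      cayley_re_nonneg (mem_closedBall_zero_iff.1 hζ.1)).norm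
    refine (analyticAt_cayley ?_).continuousAt.continuousWithinAt
    rintro rfl
    exact hδ.not_ge (by simpa using hζ.2)
  have hcircle : ∀ ζ ∈ K, ‖ζ‖ = 1 → ‖f (cayley ζ)‖ < Real.exp η := fun ζ _ hζ =>
    (hf1 _ (by simp [cayley_re, hζ])).trans_lt (Real.one_lt_exp_iff.2 hη)
  filter_upwards [(eventually_forall_norm_eq_lt_of_isCompact hK hcont hcircle).filter_mono
    nhdsWithin_le_nhds, self_mem_nhdsWithin] with r hr hr1 ζ hζ hζδ
  have hζr : ‖ζ‖ = r := mem_sphere_zero_iff_norm.1 hζ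
  have hζ1 : ‖ζ‖ < 1 := hζr.trans_lt hr1
  rw [Real.log_le_iff_le_exp (norm_pos_iff.2 (hf0 _ (cayley_re_pos_iff.2 hζ1)))]
  exact (hr ζ ⟨mem_closedBall_zero_iff.2 hζ1.le, hζδ⟩ hζr).le

theorem harmonicOnNhd_log_norm_comp_cayley {f : ℂ → ℂ} (hf : DifferentiableOn ℂ f {s | 0 < s.re})
    (hf0 : ∀ s, 0 < s.re → f s ≠ 0) :
    InnerProductSpace.HarmonicOnNhd (fun z => Real.log ‖f (cayley z)‖) (ball 0 1) := by
  intro z hz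
  have hz1 : ‖z‖ < 1 := mem_ball_zero_iff.1 hz
  have hre : 0 < (cayley z).re := cayley_re_pos_iff.2 hz1
  exact AnalyticAt.harmonicAt_log_norm (f := fun z => f (cayley z))
    ((hf.analyticAt (isOpen_re_pos.mem_nhds hre)).fun_comp
      (analyticAt_cayley (by rintro rfl; simp at hz1))) (hf0 _ hre)

namespace IsZeroFreeBoundedType

variable {f g : ℂ → ℂ}

theorem of_bounded (hf : DiffContOnCl ℂ f {s | 0 < s.re}) (hf0 : ∀ s, 0 < s.re → f s ≠ 0)
    {C : ℝ} (hC : ∀ s, 0 < s.re → ‖f s‖ ≤ C) : IsZeroFreeBoundedType f := by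
  have hm : 0 < max 1 C := lt_max_of_lt_left one_pos
  have hnorm : ‖((max 1 C : ℝ) : ℂ)⁻¹‖ = (max 1 C)⁻¹ := by
    rw [norm_inv, norm_real, Real.norm_of_nonneg hm.le]
  refine ⟨hf, hf0, fun _ => ((max 1 C : ℝ) : ℂ)⁻¹, differentiableOn_const _, fun s hs =>
    ⟨inv_ne_zero (ofReal_ne_zero.2 hm.ne'), ?_, ?_⟩⟩
  · exact hnorm ▸ inv_le_one_of_one_le₀ (le_max_left _ _)
  · rw [norm_mul, hnorm, ← div_eq_mul_inv, div_le_one hm]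
    exact (hC s hs).trans (le_max_right _ _)

theorem mul (hf : IsZeroFreeBoundedType f) (hg : IsZeroFreeBoundedType g) :
    IsZeroFreeBoundedType fun s => f s * g s := by
  obtain ⟨b, hb, hfb⟩ := hf.exists_denom
  obtain ⟨c, hc, hgc⟩ := hg.exists_denom
  refine ⟨hf.diffContOnCl.smul hg.diffContOnCl,
    fun s hs => mul_ne_zero (hf.ne_zero s hs) (hg.ne_zero s hs), fun s => b s * c s, hb.mul hc,
    fun s hs => ?_⟩
  obtain ⟨hb0, hb1, hfb1⟩ := hfb s hs
  obtain ⟨hc0, hc1, hgc1⟩ := hgc s hs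
  refine ⟨mul_ne_zero hb0 hc0, ?_, ?_⟩
  · rw [norm_mul]
    exact mul_le_one₀ hb1 (norm_nonneg _) hc1
  · rw [mul_mul_mul_comm, norm_mul]
    exact mul_le_one₀ hfb1 (norm_nonneg _) hgc1

theorem const_mul (hf : IsZeroFreeBoundedType f) {c : ℂ} (hc : c ≠ 0) :
    IsZeroFreeBoundedType fun s => c * f s :=
  (of_bounded (C := ‖c‖) diffContOnCl_const (fun _ _ => hc) fun _ _ => le_rfl).mul hf

-- `log ‖f‖` is harmonic with the positive harmonic majorant `-log ‖b‖`, so on the disc it is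
-- bounded by a multiple of the Poisson kernel at `1`, which is the real part of `cayley`.
theorem exists_norm_le_exp_mul_re (hf : IsZeroFreeBoundedType f)
    (hf1 : ∀ s, s.re = 0 → ‖f s‖ ≤ 1) : ∃ A : ℝ, ∀ s, 0 < s.re → ‖f s‖ ≤ Real.exp (A * s.re) := by
  obtain ⟨b, hb, hfb⟩ := hf.exists_denom
  have hbpos : ∀ s, 0 < s.re → 0 < ‖b s‖ := fun s hs => norm_pos_iff.2 (hfb s hs).1
  have hre : ∀ ζ ∈ ball (0 : ℂ) 1, 0 < (cayley ζ).re := fun ζ hζ =>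
    cayley_re_pos_iff.2 (mem_ball_zero_iff.1 hζ)
  refine ⟨4 * Real.log ‖(b (cayley 0))⁻¹‖, fun s hs => ?_⟩
  obtain ⟨z, rfl⟩ : ∃ z, cayley z = s :=
    ⟨_, cayley_sub_one_div_add_one (by rintro rfl; norm_num at hs)⟩
  have hlog := harmonic_le_of_majorant_of_boundary (p := 1) (by simp)
    (harmonicOnNhd_log_norm_comp_cayley hf.diffContOnCl.differentiableOn hf.ne_zero)
    (harmonicOnNhd_log_norm_comp_cayley (hb.inv fun s hs => (hfb s hs).1)
      fun s hs => inv_ne_zero (hfb s hs).1)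
    (fun ζ hζ => ?_) (fun ζ hζ => ?_)
    (fun η hη δ hδ => eventually_log_norm_comp_cayley_le
      (closure_setOfPred_lt_re 0 ▸ hf.diffContOnCl.continuousOn) hf.ne_zero hf1 hη hδ)
    (cayley_re_pos_iff.1 hs)
  · rwa [Real.log_le_iff_le_exp (norm_pos_iff.2 (hf.ne_zero _ hs)), ← cayley_re,
      mul_right_comm] at hlog
  · rw [Pi.inv_apply, norm_inv]
    exact Real.log_nonneg ((one_le_inv₀ (hbpos _ (hre ζ hζ))).2 (hfb _ (hre ζ hζ)).2.1)
  · rw [Pi.inv_apply, norm_inv]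
    refine Real.log_le_log (norm_pos_iff.2 (hf.ne_zero _ (hre ζ hζ))) ?_
    rw [← one_div, le_div_iff₀ (hbpos _ (hre ζ hζ)), ← norm_mul]
    exact (hfb _ (hre ζ hζ)).2.2

theorem norm_exp_mul_le_of_axis (hf : IsZeroFreeBoundedType f) (hf1 : ∀ s, s.re = 0 → ‖f s‖ ≤ 1)
    (hreal : ∀ ε > 0, (fun x : ℝ => f x) =o[atTop] fun x : ℝ => Real.exp (ε * x)) {ε : ℝ}
    (hε : 0 < ε) {s : ℂ} (hs : 0 ≤ s.re) : ‖exp (-ε * s) * f s‖ ≤ 1 := by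
  obtain ⟨A, hA⟩ := hf.exists_norm_le_exp_mul_re hf1
  have hexp : ∀ z : ℂ, ‖exp (-ε * z)‖ = Real.exp (-(ε * z.re)) := fun z => by simp [norm_exp]
  have hdiff : Differentiable ℂ fun z : ℂ => exp (-ε * z) := by fun_prop
  refine PhragmenLindelof.right_half_plane_of_tendsto_zero_on_real
    (f := fun z => exp (-ε * z) * f z) (hdiff.diffContOnCl.smul hf.diffContOnCl)
    ⟨1, one_lt_two, |A|, IsBigO.of_bound 1 ?_⟩ ?_ (fun x => ?_) hs
  · filter_upwards [mem_inf_of_right (mem_principal_self _)] with z (hz : 0 < z.re)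
    rw [norm_mul, hexp, Real.rpow_one, Real.norm_eq_abs, Real.abs_exp]
    refine mul_le_mul (Real.exp_le_one_iff.2 (by nlinarith)) ((hA z hz).trans ?_)
      (norm_nonneg _) zero_le_one
    refine Real.exp_le_exp.2 ((le_abs_self _).trans ?_)
    rw [abs_mul]
    exact mul_le_mul_of_nonneg_left (abs_re_le_norm z) (abs_nonneg A)
  · rw [tendsto_zero_iff_norm_tendsto_zero]
    refine (hreal ε hε).norm_left.tendsto_div_nhds_zero.congr fun x => ?_
    rw [norm_mul, hexp, ofReal_re, Real.exp_neg, inv_mul_eq_div]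
  · rw [norm_mul, hexp]
    simpa using hf1 (x * I) (by simp)

theorem norm_le_one_of_axis (hf : IsZeroFreeBoundedType f) (hf1 : ∀ s, s.re = 0 → ‖f s‖ ≤ 1)
    (hreal : ∀ ε > 0, (fun x : ℝ => f x) =o[atTop] fun x : ℝ => Real.exp (ε * x)) {s : ℂ}
    (hs : 0 ≤ s.re) : ‖f s‖ ≤ 1 := by
  have hlim : Tendsto (fun ε : ℝ => ‖exp (-ε * s) * f s‖) (𝓝[>] 0) (𝓝 ‖f s‖) :=
    (Continuous.tendsto' (by fun_prop) _ _ (by simp)).mono_left nhdsWithin_le_nhds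
  refine le_of_tendsto hlim ?_
  filter_upwards [self_mem_nhdsWithin] with ε hε
  exact hf.norm_exp_mul_le_of_axis hf1 hreal hε hs

theorem norm_le_of_axis (hf : IsZeroFreeBoundedType f) {C : ℝ} (hC : 0 < C)
    (hfC : ∀ s, s.re = 0 → ‖f s‖ ≤ C)
    (hreal : ∀ ε > 0, (fun x : ℝ => f x) =o[atTop] fun x : ℝ => Real.exp (ε * x)) {s : ℂ}
    (hs : 0 ≤ s.re) : ‖f s‖ ≤ C := by
  have hscale : ∀ z, ‖(C : ℂ)⁻¹ * f z‖ ≤ 1 ↔ ‖f z‖ ≤ C := fun z => by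
    rw [norm_mul, norm_inv, norm_real, Real.norm_of_nonneg hC.le, inv_mul_le_one₀ hC]
  exact (hscale s).1 <| (hf.const_mul (inv_ne_zero (ofReal_ne_zero.2 hC.ne'))).norm_le_one_of_axis
    (fun z hz => (hscale z).2 (hfC z hz)) (fun ε hε => (hreal ε hε).const_mul_left _) hs

end IsZeroFreeBoundedType

theorem arg_eq_arctan_of_re_pos {z : ℂ} (hz : 0 < z.re) : arg z = Real.arctan (z.im / z.re) := by
  have h := abs_lt.1 (abs_arg_lt_pi_div_two_iff.2 (Or.inl hz))
  rw [← tan_arg, Real.arctan_tan h.1 h.2]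

/-- A holomorphic function whose imaginary part at `s` is the angle under which the segment
`[-δ - i a, -δ + i a]` is seen from `s`. The shift `δ` keeps the branch points off the closed right
half-plane. -/
noncomputable def segmentAngle (a δ : ℝ) (s : ℂ) : ℂ := log (s + δ + I * a) - log (s + δ - I * a)

theorem segmentAngle_im {a δ : ℝ} {s : ℂ} (hs : 0 < s.re + δ) :
    (segmentAngle a δ s).im =
      Real.arctan ((s.im + a) / (s.re + δ)) - Real.arctan ((s.im - a) / (s.re + δ)) := by
  rw [segmentAngle, sub_im, log_im, log_im, arg_eq_arctan_of_re_pos (by simpa using hs),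
    arg_eq_arctan_of_re_pos (by simpa using hs)]
  simp

theorem segmentAngle_im_le_pi {a δ : ℝ} {s : ℂ} (hs : 0 < s.re + δ) :
    (segmentAngle a δ s).im ≤ Real.pi := by
  rw [segmentAngle_im hs]
  linarith [Real.arctan_lt_pi_div_two ((s.im + a) / (s.re + δ)),
    Real.neg_pi_div_two_lt_arctan ((s.im - a) / (s.re + δ))]

theorem segmentAngle_im_ofReal {a δ σ : ℝ} (hσ : 0 < σ + δ) :
    (segmentAngle a δ σ).im = 2 * Real.arctan (a / (σ + δ)) := by
  rw [segmentAngle_im (by simpa using hσ), ofReal_re, ofReal_im, zero_add, zero_sub, neg_div,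
    Real.arctan_neg]
  ring

theorem differentiableAt_segmentAngle {a δ : ℝ} {s : ℂ} (hs : 0 < s.re + δ) :
    DifferentiableAt ℂ (segmentAngle a δ) s := by
  have h1 : s + δ + I * a ∈ slitPlane := Or.inl (by simpa using hs)
  have h2 : s + δ - I * a ∈ slitPlane := Or.inl (by simpa using hs)
  unfold segmentAngle
  fun_prop (disch := assumption)

theorem segmentAngle_im_le_arctan {ωc κ : ℝ} (hκ : 0 < κ) {s : ℂ} (hs : s.re = 0)
    (hω : ωc ≤ |s.im|) : (segmentAngle (ωc - κ) (κ ^ 2) s).im ≤ Real.arctan κ := by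
  have hinv : Real.arctan κ⁻¹ = Real.pi / 2 - Real.arctan κ := Real.arctan_inv_of_pos hκ
  have hdiv : κ / κ ^ 2 = κ⁻¹ := by field_simp
  have hs' : 0 < s.re + κ ^ 2 := by rw [hs]; positivity
  have hmono : ∀ {x y : ℝ}, x ≤ y → Real.arctan (x / κ ^ 2) ≤ Real.arctan (y / κ ^ 2) :=
    fun h => Real.arctan_strictMono.monotone (by gcongr)
  rw [segmentAngle_im hs', hs, zero_add]
  rcases le_abs.1 hω with h | h
  · have h1 := Real.arctan_lt_pi_div_two ((s.im + (ωc - κ)) / κ ^ 2)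
    have h2 := hmono (show κ ≤ s.im - (ωc - κ) by linarith)
    rw [hdiv] at h2
    linarith
  · have h1 := Real.neg_pi_div_two_lt_arctan ((s.im - (ωc - κ)) / κ ^ 2)
    have h2 := hmono (show s.im + (ωc - κ) ≤ -κ by linarith)
    rw [neg_div, hdiv, Real.arctan_neg] at h2
    linarith

theorem norm_exp_neg_sub_I_mul (S t : ℝ) (u : ℂ) :
    ‖exp (-S - I * (t * u))‖ = Real.exp (t * u.im - S) := by
  rw [norm_exp]
  congr 1
  simp
  ring

section TwoConstants

variable {h : ℂ → ℂ} {L S ωc : ℝ} (hLS : L ≤ S)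
  (hin : ∀ s, s.re = 0 → |s.im| ≤ ωc → ‖h s‖ ≤ Real.exp L)
  (hout : ∀ s, s.re = 0 → ωc < |s.im| → ‖h s‖ ≤ Real.exp S)

include hLS hin hout in
theorem norm_mul_exp_segmentAngle_le {κ : ℝ} (hκ : 0 < κ) {s : ℂ} (hs : s.re = 0) :
    ‖h s‖ * Real.exp ((S - L) / Real.pi * (segmentAngle (ωc - κ) (κ ^ 2) s).im - S) ≤
      Real.exp ((S - L) / Real.pi * Real.arctan κ) := by
  have ht : 0 ≤ (S - L) / Real.pi := div_nonneg (sub_nonneg.2 hLS) Real.pi_pos.le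
  have hs' : 0 < s.re + κ ^ 2 := by rw [hs]; positivity
  rcases le_or_gt |s.im| ωc with hω | hω
  · have hangle := mul_le_mul_of_nonneg_left (segmentAngle_im_le_pi (a := ωc - κ) hs') ht
    rw [div_mul_cancel₀ _ Real.pi_ne_zero] at hangle
    have hκ0 : 0 ≤ (S - L) / Real.pi * Real.arctan κ :=
      mul_nonneg ht (Real.arctan_nonneg.2 hκ.le)
    refine (mul_le_mul_of_nonneg_right (hin s hs hω) (Real.exp_pos _).le).trans ?_
    rw [← Real.exp_add]
    exact Real.exp_le_exp.2 (by linarith)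
  · have hangle := mul_le_mul_of_nonneg_left (segmentAngle_im_le_arctan hκ hs hω.le) ht
    refine (mul_le_mul_of_nonneg_right (hout s hs hω) (Real.exp_pos _).le).trans ?_
    rw [← Real.exp_add]
    exact Real.exp_le_exp.2 (by linarith)

variable (hh : IsZeroFreeBoundedType h)
  (hreal : ∀ ε > 0, (fun x : ℝ => h x) =o[atTop] fun x : ℝ => Real.exp (ε * x))

include hLS hin hout hh hreal in
theorem log_norm_add_segmentAngle_le {κ : ℝ} (hκ : 0 < κ) {s : ℂ} (hs : 0 < s.re) :
    Real.log ‖h s‖ + (S - L) / Real.pi * (segmentAngle (ωc - κ) (κ ^ 2) s).im ≤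
      S + (S - L) / Real.pi * Real.arctan κ := by
  let e : ℂ → ℂ := fun s =>
    exp (-S - I * (((S - L) / Real.pi : ℝ) * segmentAngle (ωc - κ) (κ ^ 2) s))
  have hshift : ∀ {s : ℂ}, 0 ≤ s.re → 0 < s.re + κ ^ 2 := fun hs => by positivity
  have hediff : ∀ s : ℂ, 0 ≤ s.re → DifferentiableAt ℂ e s := fun s hs => by
    have := differentiableAt_segmentAngle (a := ωc - κ) (hshift hs)
    fun_prop
  have hebound : ∀ s : ℂ, 0 ≤ s.re → ‖e s‖ ≤ Real.exp (-L) := fun s hs => by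
    have hangle := mul_le_mul_of_nonneg_left (segmentAngle_im_le_pi (a := ωc - κ) (hshift hs))
      (div_nonneg (sub_nonneg.2 hLS) Real.pi_pos.le)
    rw [div_mul_cancel₀ _ Real.pi_ne_zero] at hangle
    rw [norm_exp_neg_sub_I_mul]
    exact Real.exp_le_exp.2 (by linarith)
  have he : IsZeroFreeBoundedType e := .of_bounded
    (DifferentiableOn.diffContOnCl <| by
      rw [closure_setOfPred_lt_re]
      exact fun s hs => (hediff s hs).differentiableWithinAt)
    (fun s _ => exp_ne_zero _) fun s hs => hebound s hs.le
  have hle : ‖h s * e s‖ ≤ Real.exp ((S - L) / Real.pi * Real.arctan κ) := by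
    refine (hh.mul he).norm_le_of_axis (Real.exp_pos _) (fun z hz => ?_) (fun ε hε => ?_) hs.le
    · rw [norm_mul, norm_exp_neg_sub_I_mul]
      exact norm_mul_exp_segmentAngle_le hLS hin hout hκ hz
    · have heO : (fun x : ℝ => e x) =O[atTop] fun _ => (1 : ℝ) := by
        refine IsBigO.of_bound (Real.exp (-L)) ?_
        filter_upwards [eventually_ge_atTop 0] with x hx
        simpa using hebound x hx
      simpa using (hreal ε hε).mul_isBigO heO
  have hpos : 0 < ‖h s‖ := norm_pos_iff.2 (hh.ne_zero s hs)
  rw [norm_mul, norm_exp_neg_sub_I_mul] at hle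
  have hlog := Real.log_le_log (by positivity) hle
  rw [Real.log_mul hpos.ne' (Real.exp_pos _).ne', Real.log_exp, Real.log_exp] at hlog
  linarith

include hLS hin hout hh hreal in
theorem pi_div_two_mul_log_norm_le_two_constants {σ : ℝ} (hσ : 0 < σ) :
    Real.pi / 2 * Real.log ‖h σ‖ ≤
      Real.arctan (ωc / σ) * L + (Real.pi / 2 - Real.arctan (ωc / σ)) * S := by
  have hlim : Tendsto (fun κ : ℝ => S + (S - L) / Real.pi * Real.arctan κ -
      (S - L) / Real.pi * (2 * Real.arctan ((ωc - κ) / (σ + κ ^ 2)))) (𝓝[>] 0)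
      (𝓝 (S - (S - L) / Real.pi * (2 * Real.arctan (ωc / σ)))) := by
    have hσκ : ∀ κ : ℝ, σ + κ ^ 2 ≠ 0 := fun κ => by positivity
    exact (Continuous.tendsto' (by fun_prop (disch := assumption)) _ _ (by simp)).mono_left
      nhdsWithin_le_nhds
  have hlog : Real.log ‖h σ‖ ≤ S - (S - L) / Real.pi * (2 * Real.arctan (ωc / σ)) := by
    refine ge_of_tendsto hlim ?_
    filter_upwards [self_mem_nhdsWithin] with κ (hκ : 0 < κ)
    rw [← segmentAngle_im_ofReal (by positivity), le_sub_iff_add_le]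
    exact log_norm_add_segmentAngle_le hLS hin hout hh hreal hκ (by simpa using hσ)
  calc Real.pi / 2 * Real.log ‖h σ‖
      ≤ Real.pi / 2 * (S - (S - L) / Real.pi * (2 * Real.arctan (ωc / σ))) := by gcongr
    _ = _ := by field_simp; ring

end TwoConstants

theorem one_le_norm_add_one {s : ℂ} (hs : 0 ≤ s.re) : 1 ≤ ‖s + 1‖ :=
  (le_add_of_nonneg_left hs).trans (re_le_norm (s + 1))

theorem norm_le_norm_add_one {s : ℂ} (hs : 0 ≤ s.re) : ‖s‖ ≤ ‖s + 1‖ := by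
  rw [← sq_le_sq₀ (norm_nonneg _) (norm_nonneg _), ← normSq_eq_norm_sq, ← normSq_eq_norm_sq,
    normSq_apply, normSq_apply, add_re, add_im, one_re, one_im]
  nlinarith

theorem add_one_pow_isBigO_of_le {k l : ℕ} (hkl : k ≤ l) :
    (fun s : ℂ => (s + 1) ^ k) =O[𝓟 {s | 0 ≤ s.re}] fun s => (s + 1) ^ l :=
  isBigO_principal.2 ⟨1, fun s hs => by
    simpa using pow_le_pow_right₀ (one_le_norm_add_one hs) hkl⟩

/-- The algebra of functions of at most polynomial growth on the closed right half-plane; the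
comparison function `s + 1` has norm at least `1` there. -/
def polyGrowth : Subalgebra ℂ (ℂ → ℂ) where
  carrier := {F | ∃ k : ℕ, F =O[𝓟 {s | 0 ≤ s.re}] fun s => (s + 1) ^ k}
  add_mem' := by
    rintro F G ⟨k, hF⟩ ⟨l, hG⟩
    exact ⟨max k l, (hF.trans (add_one_pow_isBigO_of_le (le_max_left k l))).add
      (hG.trans (add_one_pow_isBigO_of_le (le_max_right k l)))⟩
  mul_mem' := by
    rintro F G ⟨k, hF⟩ ⟨l, hG⟩
    refine ⟨k + l, ?_⟩
    simp only [pow_add]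
    exact hF.mul hG
  algebraMap_mem' c := by
    refine ⟨0, ?_⟩
    simp only [pow_zero]
    exact isBigO_const_const c one_ne_zero _

section PolyGrowth

variable {F : ℂ → ℂ}

theorem mem_polyGrowth_of_isBigO_one (hF : F =O[𝓟 {s | 0 ≤ s.re}] fun _ => (1 : ℂ)) :
    F ∈ polyGrowth :=
  ⟨0, by simpa only [pow_zero] using hF⟩

theorem id_mem_polyGrowth : id ∈ polyGrowth :=
  ⟨1, isBigO_principal.2 ⟨1, fun s hs => by simpa using norm_le_norm_add_one hs⟩⟩

theorem aeval_mem_polyGrowth (p : Polynomial ℝ) :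
    (fun s : ℂ => Polynomial.aeval s p) ∈ polyGrowth := by
  let z : polyGrowth := ⟨id, id_mem_polyGrowth⟩
  convert (Polynomial.aeval z (p.map (algebraMap ℝ ℂ))).2 using 2 with s
  rw [Polynomial.aeval_subalgebra_coe, Polynomial.aeval_fn_apply, Polynomial.aeval_map_algebraMap]
  rfl

theorem mem_polyGrowth_of_sub_mul {γ : ℂ} (hF : Continuous F)
    (h : (fun s => (s - γ) * F s) ∈ polyGrowth) : F ∈ polyGrowth := by
  have hnear : F =O[𝓟 (closedBall γ 1)] fun _ => (1 : ℂ) :=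
    hF.continuousOn.isBigO_principal (isCompact_closedBall γ 1) (by simp)
  have hfar : F =O[𝓟 (closedBall γ 1)ᶜ] fun s => (s - γ) * F s := by
    refine isBigO_principal.2 ⟨1, fun s hs => ?_⟩
    have hsγ : 1 ≤ ‖s - γ‖ := (not_le.1 fun h => hs (mem_closedBall_iff_norm.2 h)).le
    rw [norm_mul, one_mul]
    exact le_mul_of_one_le_left (norm_nonneg _) hsγ
  obtain ⟨k, hk⟩ := h
  have hone : (fun _ : ℂ => (1 : ℂ)) =O[𝓟 {s | 0 ≤ s.re}] fun s => (s + 1) ^ k := by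
    simpa only [pow_zero] using add_one_pow_isBigO_of_le k.zero_le
  have hsplit : 𝓟 {s : ℂ | 0 ≤ s.re} =
      𝓟 {s : ℂ | 0 ≤ s.re} ⊓ 𝓟 (closedBall γ 1) ⊔ 𝓟 {s : ℂ | 0 ≤ s.re} ⊓ 𝓟 (closedBall γ 1)ᶜ := by
    rw [inf_principal, inf_principal, sup_principal, Set.inter_union_compl]
  refine ⟨k, ?_⟩
  rw [hsplit]
  refine IsBigO.sup ?_ ?_
  · exact (hnear.mono inf_le_right).trans (hone.mono inf_le_left)
  · exact (hfar.mono inf_le_right).trans (hk.mono inf_le_left)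

theorem isLittleO_exp_of_mem_polyGrowth (hF : F ∈ polyGrowth) {ε : ℝ} (hε : 0 < ε) :
    (fun x : ℝ => F x) =o[atTop] fun x : ℝ => Real.exp (ε * x) := by
  obtain ⟨k, hk⟩ := hF
  have hmap : Tendsto (fun x : ℝ => (x : ℂ)) atTop (𝓟 {s | 0 ≤ s.re}) := by
    refine tendsto_principal.2 ?_
    filter_upwards [eventually_ge_atTop 0] with x hx
    simpa using hx
  have hadd : (fun x : ℝ => (x : ℂ) + 1) =O[atTop] fun x : ℝ => x := by
    refine IsBigO.of_bound 2 ?_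
    filter_upwards [eventually_ge_atTop 1] with x hx
    rw [← ofReal_one, ← ofReal_add, norm_real, Real.norm_of_nonneg (by linarith),
      Real.norm_of_nonneg (by linarith)]
    linarith
  exact ((hk.comp_tendsto hmap).trans (hadd.pow k)).trans_isLittleO
    (isLittleO_pow_exp_pos_mul_atTop k hε)

end PolyGrowth

namespace IsZeroFreeBoundedType

variable {f g : ℂ → ℂ}

theorem inv (hf : IsZeroFreeBoundedType f) (hf0 : ∀ s, s.re = 0 → f s ≠ 0) :
    IsZeroFreeBoundedType fun s => (f s)⁻¹ := by
  obtain ⟨b, hb, hfb⟩ := hf.exists_denom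
  refine ⟨hf.diffContOnCl.inv fun s hs => ?_, fun s hs => inv_ne_zero (hf.ne_zero s hs),
    fun s => f s * b s, hf.diffContOnCl.differentiableOn.mul hb, fun s hs => ?_⟩
  · rw [closure_setOfPred_lt_re] at hs
    exact (lt_or_eq_of_le hs).elim (hf.ne_zero s) fun h => hf0 s h.symm
  · obtain ⟨hb0, hb1, hfb1⟩ := hfb s hs
    exact ⟨mul_ne_zero (hf.ne_zero s hs) hb0, hfb1, by
      rwa [inv_mul_cancel_left₀ (hf.ne_zero s hs)]⟩

-- Both `f / (s + 1) ^ k` and `1 / (s + 1) ^ k` are bounded, for large `k`.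
theorem of_mem_polyGrowth (hf : DiffContOnCl ℂ f {s | 0 < s.re}) (hf0 : ∀ s, 0 < s.re → f s ≠ 0)
    (hpoly : f ∈ polyGrowth) : IsZeroFreeBoundedType f := by
  obtain ⟨k, hk⟩ := hpoly
  obtain ⟨C, hC⟩ := isBigO_principal.1 hk
  have hpow : ∀ s : ℂ, 0 ≤ s.re → 1 ≤ ‖(s + 1) ^ k‖ := fun s hs => by
    rw [norm_pow]
    exact one_le_pow₀ (one_le_norm_add_one hs)
  have hpow0 : ∀ s : ℂ, 0 ≤ s.re → (s + 1) ^ k ≠ 0 := fun s hs =>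
    norm_pos_iff.1 (one_pos.trans_le (hpow s hs))
  have hdiff : DiffContOnCl ℂ (fun s : ℂ => ((s + 1) ^ k)⁻¹) {s | 0 < s.re} :=
    DiffContOnCl.inv (Differentiable.diffContOnCl (by fun_prop)) fun s hs =>
      hpow0 s (by rwa [closure_setOfPred_lt_re] at hs)
  have hinv : IsZeroFreeBoundedType fun s => ((s + 1) ^ k)⁻¹ :=
    of_bounded (C := 1) hdiff (fun s hs => inv_ne_zero (hpow0 s hs.le)) fun s hs => by
      rw [norm_inv]
      exact inv_le_one_of_one_le₀ (hpow s hs.le)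
  have hquot : IsZeroFreeBoundedType fun s => f s * ((s + 1) ^ k)⁻¹ :=
    of_bounded (C := C) (hf.smul hdiff)
      (fun s hs => mul_ne_zero (hf0 s hs) (inv_ne_zero (hpow0 s hs.le))) fun s hs => by
      rw [norm_mul, norm_inv, ← div_eq_mul_inv, div_le_iff₀ (one_pos.trans_le (hpow s hs.le))]
      exact hC s hs.le
  obtain ⟨b, hb, hfb⟩ :=
    (hquot.mul (hinv.inv fun s hs => inv_ne_zero (hpow0 s hs.ge))).exists_denom
  refine ⟨hf, hf0, b, hb, fun s hs => ?_⟩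
  simpa only [inv_inv, inv_mul_cancel_right₀ (hpow0 s hs.le)] using hfb s hs

end IsZeroFreeBoundedType

theorem exists_eq_sub_mul_of_apply_eq_zero {F : ℂ → ℂ} {γ : ℂ} (hF : Differentiable ℂ F)
    (hγ : F γ = 0) : ∃ F₁ : ℂ → ℂ, Differentiable ℂ F₁ ∧ ∀ s, F s = (s - γ) * F₁ s := by
  refine ⟨dslope F γ, ?_, fun s => ?_⟩
  · rw [← differentiableOn_univ, differentiableOn_dslope univ_mem]
    exact hF.differentiableOn
  · rw [← smul_eq_mul, sub_smul_dslope, hγ, sub_zero]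

theorem exists_eq_prod_sub_mul {ι : Type*} (t : Finset ι) {γ : ι → ℂ} {U : Set ℂ} {F : ℂ → ℂ}
    (hF : Differentiable ℂ F) (hγ : ∀ i ∈ t, γ i ∈ U)
    (hord : ∀ z ∈ U, analyticOrderAt F z = (Finset.card {i ∈ t | γ i = z} : ℕ∞)) :
    ∃ F₁ : ℂ → ℂ, Differentiable ℂ F₁ ∧ (∀ s, F s = (∏ i ∈ t, (s - γ i)) * F₁ s) ∧
      ∀ s ∈ U, F₁ s ≠ 0 := by
  classical
  induction t using Finset.induction_on generalizing F with
  | empty =>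
    refine ⟨F, hF, by simp, fun s hs => (hF.analyticAt s).analyticOrderAt_eq_zero.1 ?_⟩
    simpa using hord s hs
  | insert j t hj ih =>
    have hcard : ∀ z, Finset.card {i ∈ insert j t | γ i = z} =
        (if γ j = z then 1 else 0) + Finset.card {i ∈ t | γ i = z} := fun z => by
      rw [Finset.card_filter, Finset.sum_insert hj, Finset.card_filter]
    have hFj : F (γ j) = 0 := apply_eq_zero_of_analyticOrderAt_ne_zero (𝕜 := ℂ) <| by
      rw [hord _ (hγ j (t.mem_insert_self j)), hcard]
      simp
    obtain ⟨G, hG, hFG⟩ := exists_eq_sub_mul_of_apply_eq_zero hF hFj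
    have hord' : ∀ z ∈ U, analyticOrderAt G z = (Finset.card {i ∈ t | γ i = z} : ℕ∞) := by
      intro z hz
      have hlin : analyticOrderAt (fun s : ℂ => s - γ j) z =
          ((if γ j = z then 1 else 0 : ℕ) : ℕ∞) := by
        split_ifs with h
        · simp [h]
        · simpa using analyticOrderAt_id_sub_const_of_ne (Ne.symm h)
      have hmul := analyticOrderAt_mul (f := fun s : ℂ => s - γ j) (by fun_prop) (hG.analyticAt z)
      rw [show (fun s => s - γ j) * G = F from funext fun s => (hFG s).symm, hord z hz, hcard,
        Nat.cast_add, hlin] at hmul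
      exact ((WithTop.add_left_inj (ENat.natCast_ne_top _)).1 hmul).symm
    obtain ⟨F₁, hF₁, hGF₁, hF₁0⟩ := ih hG (fun i hi => hγ i (Finset.mem_insert_of_mem hi)) hord'
    refine ⟨F₁, hF₁, fun s => ?_, hF₁0⟩
    rw [hFG, hGF₁, Finset.prod_insert hj, mul_assoc]

theorem mem_polyGrowth_of_prod_sub_mul {ι : Type*} (t : Finset ι) {γ : ι → ℂ} {F : ℂ → ℂ}
    (hF : Continuous F) (h : (fun s => (∏ i ∈ t, (s - γ i)) * F s) ∈ polyGrowth) :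
    F ∈ polyGrowth := by
  classical
  induction t using Finset.induction_on with
  | empty => simpa using h
  | insert j t hj ih =>
    refine ih (mem_polyGrowth_of_sub_mul (γ := γ j) (by fun_prop) ?_)
    simpa only [Finset.prod_insert hj, mul_assoc] using h

theorem prod_add_mem_polyGrowth {ι : Type*} (t : Finset ι) (c : ι → ℂ) :
    (fun s => ∏ i ∈ t, (s + c i)) ∈ polyGrowth := by
  have hmem : ∏ i ∈ t, (id + algebraMap ℂ (ℂ → ℂ) (c i)) ∈ polyGrowth :=
    prod_mem fun i _ => add_mem id_mem_polyGrowth (polyGrowth.algebraMap_mem _)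
  convert hmem using 2 with s
  simp

theorem norm_add_conj_sq (s γ : ℂ) :
    ‖s + conj γ‖ ^ 2 = ‖s - γ‖ ^ 2 + 4 * (s.re * γ.re) := by
  rw [← normSq_eq_norm_sq, ← normSq_eq_norm_sq, normSq_apply, normSq_apply]
  simp only [add_re, add_im, sub_re, sub_im, conj_re, conj_im]
  ring

theorem norm_add_conj_eq {s γ : ℂ} (hs : s.re = 0) : ‖s + conj γ‖ = ‖s - γ‖ := by
  rw [← sq_eq_sq₀ (norm_nonneg _) (norm_nonneg _), norm_add_conj_sq, hs]
  ring

theorem norm_sub_le_norm_add_conj {s γ : ℂ} (hs : 0 ≤ s.re) (hγ : 0 ≤ γ.re) :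
    ‖s - γ‖ ≤ ‖s + conj γ‖ := by
  rw [← sq_le_sq₀ (norm_nonneg _) (norm_nonneg _), norm_add_conj_sq]
  exact le_add_of_nonneg_right (by positivity)

theorem add_conj_ne_zero {s γ : ℂ} (hs : 0 ≤ s.re) (hγ : 0 < γ.re) : s + conj γ ≠ 0 := by
  intro h
  have hre := congrArg re h
  rw [add_re, conj_re, zero_re] at hre
  linarith

/-- `P` is `F` with each zero `γ i` in the right half-plane replaced by its mirror image
`-conj (γ i)` (division by a Blaschke product), stated without division; `P` has no further zeros
there. -/
structure IsZeroReflection {ι : Type*} [Fintype ι] (γ : ι → ℂ) (F P : ℂ → ℂ) : Prop where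
  re_pos : ∀ i, 0 < (γ i).re
  differentiable : Differentiable ℂ P
  ne_zero : ∀ s, 0 < s.re → P s ≠ 0
  prod_mul_eq : ∀ s, (∏ i, (s + conj (γ i))) * F s = (∏ i, (s - γ i)) * P s

theorem exists_isZeroReflection {ι : Type*} [Fintype ι] {γ : ι → ℂ} {F : ℂ → ℂ}
    (hF : Differentiable ℂ F) (hγ : ∀ i, 0 < (γ i).re)
    (hord : ∀ z, 0 < z.re → analyticOrderAt F z = (Nat.card {i // γ i = z} : ℕ∞)) :
    ∃ P, IsZeroReflection γ F P := by
  classical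
  obtain ⟨F₁, hF₁, hfac, hF₁0⟩ := exists_eq_prod_sub_mul Finset.univ (U := {s | 0 < s.re}) hF
    (fun i _ => hγ i) fun z hz => by
      rw [hord z hz, Nat.card_eq_fintype_card, Fintype.card_subtype]
  refine ⟨fun s => (∏ i, (s + conj (γ i))) * F₁ s, hγ, by fun_prop, fun s hs => mul_ne_zero
    (Finset.prod_ne_zero_iff.2 fun i _ => add_conj_ne_zero hs.le (hγ i)) (hF₁0 s hs),
    fun s => ?_⟩
  rw [hfac]
  ring

namespace IsZeroReflection

variable {ι : Type*} [Fintype ι] {γ : ι → ℂ} {F P : ℂ → ℂ}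

theorem mem_polyGrowth (hP : IsZeroReflection γ F P) (hF : F ∈ polyGrowth) : P ∈ polyGrowth := by
  refine mem_polyGrowth_of_prod_sub_mul Finset.univ hP.differentiable.continuous (γ := γ) ?_
  simp only [← hP.prod_mul_eq]
  exact mul_mem (prod_add_mem_polyGrowth Finset.univ fun i => conj (γ i)) hF

theorem norm_prod_pos (hP : IsZeroReflection γ F P) {s : ℂ} (hs : 0 ≤ s.re) :
    0 < ‖∏ i, (s + conj (γ i))‖ :=
  norm_pos_iff.2 (Finset.prod_ne_zero_iff.2 fun i _ => add_conj_ne_zero hs (hP.re_pos i))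

theorem norm_eq_of_re_eq_zero (hP : IsZeroReflection γ F P) {s : ℂ} (hs : s.re = 0) :
    ‖P s‖ = ‖F s‖ := by
  have hprod : ‖∏ i, (s + conj (γ i))‖ = ‖∏ i, (s - γ i)‖ := by
    simp only [norm_prod, norm_add_conj_eq hs]
  have heq := congrArg norm (hP.prod_mul_eq s)
  rw [norm_mul, norm_mul, ← hprod] at heq
  exact (mul_left_cancel₀ (hP.norm_prod_pos hs.ge).ne' heq).symm

theorem norm_le (hP : IsZeroReflection γ F P) {s : ℂ} (hs : 0 ≤ s.re) : ‖F s‖ ≤ ‖P s‖ := by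
  have hprod : ‖∏ i, (s - γ i)‖ ≤ ‖∏ i, (s + conj (γ i))‖ := by
    simp only [norm_prod]
    gcongr with i
    exact norm_sub_le_norm_add_conj hs (hP.re_pos i).le
  refine le_of_mul_le_mul_left ?_ (hP.norm_prod_pos hs)
  rw [← norm_mul, hP.prod_mul_eq, norm_mul]
  gcongr

theorem apply_ne_zero (hP : IsZeroReflection γ F P) {s : ℂ} (hs : 0 < s.re) (hγ : ∀ i, s ≠ γ i) :
    F s ≠ 0 := by
  refine right_ne_zero_of_mul (a := ∏ i, (s + conj (γ i))) ?_
  rw [hP.prod_mul_eq]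
  exact mul_ne_zero (Finset.prod_ne_zero_iff.2 fun i _ => sub_ne_zero.2 (hγ i)) (hP.ne_zero s hs)

theorem log_norm_eq (hP : IsZeroReflection γ F P) {s : ℂ} (hs : 0 < s.re) (hγ : ∀ i, s ≠ γ i) :
    Real.log ‖F s‖ = ∑ i, Real.log ‖(s - γ i) / (s + conj (γ i))‖ + Real.log ‖P s‖ := by
  have hconj : ∀ i, s + conj (γ i) ≠ 0 := fun i => add_conj_ne_zero hs.le (hP.re_pos i)
  have hfac : F s = (∏ i, (s - γ i) / (s + conj (γ i))) * P s := by
    rw [Finset.prod_div_distrib, div_mul_eq_mul_div, ← hP.prod_mul_eq,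
      mul_div_cancel_left₀ _ (Finset.prod_ne_zero_iff.2 fun i _ => hconj i)]
  have hne : ∀ i, ‖(s - γ i) / (s + conj (γ i))‖ ≠ 0 := fun i =>
    norm_ne_zero_iff.2 (div_ne_zero (sub_ne_zero.2 (hγ i)) (hconj i))
  rw [hfac, norm_mul, norm_prod, Real.log_mul (Finset.prod_ne_zero_iff.2 fun i _ => hne i)
    (norm_ne_zero_iff.2 (hP.ne_zero s hs)), Real.log_prod fun i _ => hne i]

theorem isZeroFreeBoundedType (hP : IsZeroReflection γ F P) (hF : F ∈ polyGrowth) :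
    IsZeroFreeBoundedType P :=
  .of_mem_polyGrowth hP.differentiable.diffContOnCl hP.ne_zero (hP.mem_polyGrowth hF)

theorem log_norm_mul_inv_eq {M N : ℕ} {α : Fin M → ℂ} {β : Fin N → ℂ} {D P F Q : ℂ → ℂ}
    (hP : IsZeroReflection α D P) (hQ : IsZeroReflection β F Q) {σ : ℝ} (hσ : 0 < σ)
    (hσα : ∀ i, (σ : ℂ) ≠ α i) (hσβ : ∀ j, (σ : ℂ) ≠ β j) :
    Real.log ‖P σ * (Q σ)⁻¹‖ = Real.log ‖D σ / F σ‖ - blaschkeTerms α β σ := by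
  have hσre : 0 < (σ : ℂ).re := hσ
  have hβ_inv : ∀ j, Real.log ‖((σ : ℂ) + conj (β j)) / ((σ : ℂ) - β j)‖ =
      -Real.log ‖((σ : ℂ) - β j) / ((σ : ℂ) + conj (β j))‖ := fun j => by
    rw [← inv_div, norm_inv, Real.log_inv]
  rw [blaschkeTerms, norm_div, norm_mul, norm_inv,
    Real.log_div (norm_ne_zero_iff.2 (hP.apply_ne_zero hσre hσα))
      (norm_ne_zero_iff.2 (hQ.apply_ne_zero hσre hσβ)),
    Real.log_mul (norm_ne_zero_iff.2 (hP.ne_zero σ hσre))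
      (inv_ne_zero (norm_ne_zero_iff.2 (hQ.ne_zero σ hσre))),
    Real.log_inv, hP.log_norm_eq hσre hσα, hQ.log_norm_eq hσre hσβ]
  simp only [hβ_inv, Finset.sum_neg_distrib]
  ring

end IsZeroReflection

theorem pi_div_two_mul_log_norm_div_sub_blaschkeTerms_le {M N : ℕ} {α : Fin M → ℂ}
    {β : Fin N → ℂ} {D F : ℂ → ℂ} (hD : Differentiable ℂ D) (hDpoly : D ∈ polyGrowth)
    (hF : Differentiable ℂ F) (hFpoly : F ∈ polyGrowth)
    (hα : ∀ i, 0 < (α i).re) (hβ : ∀ j, 0 < (β j).re)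
    (hDord : ∀ z, 0 < z.re → analyticOrderAt D z = (Nat.card {i // α i = z} : ℕ∞))
    (hFord : ∀ z, 0 < z.re → analyticOrderAt F z = (Nat.card {j // β j = z} : ℕ∞))
    (hFaxis : ∀ s, s.re = 0 → F s ≠ 0)
    (hFreal : (fun _ => (1 : ℝ)) =O[atTop] fun x : ℝ => F x)
    {L S ωc : ℝ} (hLS : L ≤ S)
    (hin : ∀ s, s.re = 0 → |s.im| ≤ ωc → ‖D s / F s‖ ≤ Real.exp L)
    (hout : ∀ s, s.re = 0 → ωc < |s.im| → ‖D s / F s‖ ≤ Real.exp S)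
    {σ : ℝ} (hσ : 0 < σ) (hσα : ∀ i, (σ : ℂ) ≠ α i) (hσβ : ∀ j, (σ : ℂ) ≠ β j) :
    Real.pi / 2 * (Real.log ‖D σ / F σ‖ - blaschkeTerms α β σ) ≤
      Real.arctan (ωc / σ) * L + (Real.pi / 2 - Real.arctan (ωc / σ)) * S := by
  obtain ⟨P, hP⟩ := exists_isZeroReflection hD hα hDord
  obtain ⟨Q, hQ⟩ := exists_isZeroReflection hF hβ hFord
  have hQaxis : ∀ s, s.re = 0 → Q s ≠ 0 := fun s hs => by
    rw [← norm_ne_zero_iff, hQ.norm_eq_of_re_eq_zero hs, norm_ne_zero_iff]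
    exact hFaxis s hs
  have haxis : ∀ s, s.re = 0 → ‖P s * (Q s)⁻¹‖ = ‖D s / F s‖ := fun s hs => by
    rw [← div_eq_mul_inv, norm_div, norm_div, hP.norm_eq_of_re_eq_zero hs,
      hQ.norm_eq_of_re_eq_zero hs]
  have hFQ : (fun x : ℝ => F x) =O[atTop] fun x : ℝ => Q x := by
    refine .of_bound' ?_
    filter_upwards [eventually_ge_atTop 0] with x hx
    exact hQ.norm_le (by simpa using hx)
  have hQinv : (fun x : ℝ => (Q x)⁻¹) =O[atTop] fun _ => (1 : ℝ) := by
    simpa using (hFreal.trans hFQ).inv_rev (by simp)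
  rw [← hP.log_norm_mul_inv_eq hQ hσ hσα hσβ]
  refine pi_div_two_mul_log_norm_le_two_constants (h := fun s => P s * (Q s)⁻¹) hLS
    (fun s hs hsω => (haxis s hs).trans_le (hin s hs hsω))
    (fun s hs hsω => (haxis s hs).trans_le (hout s hs hsω))
    ((hP.isZeroFreeBoundedType hDpoly).mul ((hQ.isZeroFreeBoundedType hFpoly).inv hQaxis))
    (fun ε hε => ?_) hσ
  simpa using (isLittleO_exp_of_mem_polyGrowth (hP.mem_polyGrowth hDpoly) hε).mul_isBigO hQinv

theorem ne_zero_of_norm_div_le_nhdsNE {X : Type*} [TopologicalSpace X] {D F : X → ℂ} {x : X}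
    [(𝓝[≠] x).NeBot] {B : ℝ} (hD : ContinuousAt D x) (hF : ContinuousAt F x) (hDx : D x ≠ 0)
    (hF0 : ∀ᶠ y in 𝓝[≠] x, F y ≠ 0) (hB : ∀ᶠ y in 𝓝[≠] x, ‖D y / F y‖ ≤ B) : F x ≠ 0 := by
  intro hFx
  have hle : ∀ᶠ y in 𝓝[≠] x, ‖D y‖ ≤ B * ‖F y‖ := by
    filter_upwards [hF0, hB] with y hFy hBy
    rwa [norm_div, div_le_iff₀ (norm_pos_iff.2 hFy)] at hBy
  have hlim : ‖D x‖ ≤ B * ‖F x‖ := le_of_tendsto_of_tendsto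
    (hD.norm.tendsto.mono_left nhdsWithin_le_nhds)
    ((hF.norm.const_mul B).tendsto.mono_left nhdsWithin_le_nhds) hle
  rw [hFx, norm_zero, mul_zero] at hlim
  exact hDx (norm_le_zero_iff.1 hlim)

theorem ne_zero_on_axis_of_norm_div_le {D F : ℂ → ℂ} {B : ℝ} (hD : Continuous D)
    (hF : Differentiable ℂ F) (hF0 : F ≠ 0) (hDF : ∀ s, s.re = 0 → D s ≠ 0 ∨ F s ≠ 0)
    (hB : ∀ s, s.re = 0 → ‖D s / F s‖ ≤ B) {s : ℂ} (hs : s.re = 0) : F s ≠ 0 := by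
  rcases hDF s hs with hDs | hFs
  swap
  · exact hFs
  obtain ⟨ω₀, rfl⟩ : ∃ ω : ℝ, I * ω = s := ⟨s.im, by simp [Complex.ext_iff, hs]⟩
  have hI : Continuous fun ω : ℝ => I * (ω : ℂ) := by fun_prop
  have hI_inj : Function.Injective fun ω : ℝ => I * (ω : ℂ) := fun ω ω' h => by simpa using h
  have hev : ∀ᶠ z in 𝓝[≠] (I * ω₀ : ℂ), F z ≠ 0 := by
    by_contra hfreq
    rw [not_eventually] at hfreq
    refine hF0 (funext fun z => ?_)
    exact AnalyticOnNhd.eqOn_zero_of_preconnected_of_frequently_eq_zero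
      (fun z _ => hF.analyticAt z) isPreconnected_univ (Set.mem_univ _)
      (hfreq.mono fun z => not_not.1) (Set.mem_univ z)
  exact ne_zero_of_norm_div_le_nhdsNE (x := ω₀) (hD.comp hI).continuousAt
    (hF.continuous.comp hI).continuousAt hDs
    ((hI.continuousWithinAt.tendsto_nhdsWithin fun ω hω => hI_inj.ne hω).eventually hev)
    (Eventually.of_forall fun ω => hB _ (by simp))

theorem analyticOrderAt_eq_of_meromorphicOrderAt_div {D F : ℂ → ℂ} {z : ℂ}
    (hD : AnalyticAt ℂ D z) (hF : AnalyticAt ℂ F z) (hDF : D z ≠ 0 ∨ F z ≠ 0) {m n : ℕ}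
    (hmn : m = 0 ∨ n = 0)
    (hord : meromorphicOrderAt (D / F) z = (((m : ℤ) - (n : ℤ) : ℤ) : WithTop ℤ)) :
    analyticOrderAt D z = m ∧ analyticOrderAt F z = n := by
  have hzero : analyticOrderAt D z = 0 ∨ analyticOrderAt F z = 0 :=
    hDF.imp hD.analyticOrderAt_eq_zero.2 hF.analyticOrderAt_eq_zero.2
  have htop : meromorphicOrderAt (D / F) z ≠ ⊤ := hord ▸ WithTop.coe_ne_top
  rw [meromorphicOrderAt_div hD.meromorphicAt hF.meromorphicAt, hD.meromorphicOrderAt_eq,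
    hF.meromorphicOrderAt_eq] at hord htop
  generalize analyticOrderAt D z = d at hzero hord htop ⊢
  generalize analyticOrderAt F z = f at hzero hord htop ⊢
  have hd : d ≠ ⊤ := by
    rintro rfl
    simp at htop
  have hf : f ≠ ⊤ := by
    rintro rfl
    cases d <;> simp at htop
  lift d to ℕ using hd
  lift f to ℕ using hf
  simp only [ENat.map_natCast] at hord
  norm_cast at hord hzero ⊢
  lia

/-- The closed-loop characteristic function: the denominator of the sensitivity, so that the poles
of the sensitivity are among its zeros. -/
noncomputable def closedLoopChar (R : RatFunc ℝ) (τ : ℝ) (s : ℂ) : ℂ :=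
  Polynomial.aeval s R.denom + Polynomial.aeval s R.num * exp (-(τ * s))

section Sensitivity

variable (R : RatFunc ℝ) {τ : ℝ}

theorem sensitivity_eq_aeval_denom_div (τ : ℝ) (s : ℂ) :
    sensitivity R τ s = Polynomial.aeval s R.denom / closedLoopChar R τ s := rfl

theorem differentiable_closedLoopChar (τ : ℝ) : Differentiable ℂ (closedLoopChar R τ) :=
  R.denom.differentiable_aeval.fun_add (R.num.differentiable_aeval.fun_mul (by fun_prop))

theorem aeval_denom_ne_zero_or_closedLoopChar_ne_zero (τ : ℝ) (s : ℂ) :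
    Polynomial.aeval s R.denom ≠ 0 ∨ closedLoopChar R τ s ≠ 0 := by
  refine or_iff_not_imp_left.2 fun hD => ?_
  rw [not_not] at hD
  rw [closedLoopChar, hD, zero_add]
  exact mul_ne_zero ((Polynomial.aeval_ne_zero_of_isCoprime R.isCoprime_num_denom s).resolve_right
    (not_not.2 hD)) (exp_ne_zero _)

theorem exp_neg_mul_mem_polyGrowth (hτ : 0 ≤ τ) : (fun s : ℂ => exp (-(τ * s))) ∈ polyGrowth := by
  refine mem_polyGrowth_of_isBigO_one (isBigO_principal.2 ⟨1, fun s hs => ?_⟩)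
  have hτs : 0 ≤ τ * s.re := mul_nonneg hτ hs
  simpa [norm_exp] using hτs

theorem closedLoopChar_mem_polyGrowth (hτ : 0 ≤ τ) : closedLoopChar R τ ∈ polyGrowth :=
  add_mem (aeval_mem_polyGrowth R.denom)
    (mul_mem (aeval_mem_polyGrowth R.num) (exp_neg_mul_mem_polyGrowth hτ))

theorem one_isBigO_aeval {p : Polynomial ℝ} (hp : p ≠ 0) :
    (fun _ => (1 : ℝ)) =O[atTop] fun x : ℝ => Polynomial.aeval (x : ℂ) p := by
  have heval : (fun _ => (1 : ℝ)) =O[atTop] p.eval := by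
    simpa using Polynomial.isBigO_atTop_of_degree_le (1 : Polynomial ℝ) p
      (by rw [Polynomial.degree_one]; exact Polynomial.zero_le_degree_iff.2 hp)
  refine heval.trans (.of_bound' (.of_forall fun x => ?_))
  rw [← coe_algebraMap, Polynomial.aeval_algebraMap_apply_eq_algebraMap_eval, coe_algebraMap,
    norm_real]

theorem one_isBigO_closedLoopChar (hτ : 0 ≤ τ) (hne : closedLoopChar R τ ≠ 0) :
    (fun _ => (1 : ℝ)) =O[atTop] fun x : ℝ => closedLoopChar R τ x := by
  rcases hτ.eq_or_lt with rfl | hτ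
  · have hpoly : ∀ s : ℂ, closedLoopChar R 0 s = Polynomial.aeval s (R.denom + R.num) := fun s => by
      simp [closedLoopChar]
    simp only [hpoly]
    refine one_isBigO_aeval fun h0 => hne (funext fun s => ?_)
    rw [hpoly, h0, map_zero, Pi.zero_apply]
  · have hdenom := one_isBigO_aeval R.denom_ne_zero
    have hexp : (fun x : ℝ => exp (-(τ * x))) =O[atTop] fun x : ℝ => (Real.exp (τ * x))⁻¹ :=
      .of_bound' (.of_forall fun x => by simp [norm_exp, Real.exp_neg])
    have hdelay : (fun x : ℝ => Polynomial.aeval (x : ℂ) R.num * exp (-(τ * x))) =o[atTop]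
        fun _ => (1 : ℝ) := by
      simpa using (isLittleO_exp_of_mem_polyGrowth (aeval_mem_polyGrowth R.num) hτ).mul_isBigO hexp
    exact hdenom.trans (hdelay.trans_isBigO hdenom).right_isBigO_add'

theorem sensitivity_conj (τ : ℝ) (s : ℂ) :
    sensitivity R τ (conj s) = conj (sensitivity R τ s) := by
  simp [sensitivity, Polynomial.aeval_conj, ← exp_conj]

theorem norm_sensitivity_I_mul_abs_im (τ : ℝ) {s : ℂ} (hs : s.re = 0) :
    ‖sensitivity R τ (I * |s.im|)‖ = ‖sensitivity R τ s‖ := by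
  rcases abs_choice s.im with h | h
  · congr
    simp [Complex.ext_iff, hs, h]
  · rw [← norm_conj (sensitivity R τ s), ← sensitivity_conj]
    congr
    simp [Complex.ext_iff, hs, h]

end Sensitivity

namespace IsRHPZeroPoleList

variable {R : RatFunc ℝ} {τ : ℝ} {M N : ℕ} {α : Fin M → ℂ} {β : Fin N → ℂ}

theorem analyticOrderAt_eq (hαβ : IsRHPZeroPoleList (sensitivity R τ) α β) {z : ℂ}
    (hz : 0 < z.re) :
    analyticOrderAt (fun s : ℂ => Polynomial.aeval s R.denom) z =
        (Nat.card {i // α i = z} : ℕ∞) ∧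
      analyticOrderAt (closedLoopChar R τ) z = (Nat.card {j // β j = z} : ℕ∞) := by
  obtain ⟨-, -, hdisj, hord⟩ := hαβ
  have hcard : Nat.card {i // α i = z} = 0 ∨ Nat.card {j // β j = z} = 0 := by
    simp only [Finite.card_eq_zero_iff, isEmpty_subtype]
    by_contra! h
    obtain ⟨⟨i, hi⟩, j, hj⟩ := h
    exact hdisj i j (hi.trans hj.symm)
  exact analyticOrderAt_eq_of_meromorphicOrderAt_div
    (R.denom.differentiable_aeval.analyticAt z)
    ((differentiable_closedLoopChar R τ).analyticAt z)
    (aeval_denom_ne_zero_or_closedLoopChar_ne_zero R τ z) hcard (hord z hz)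

theorem closedLoopChar_ne_zero (hαβ : IsRHPZeroPoleList (sensitivity R τ) α β) :
    closedLoopChar R τ ≠ 0 := by
  intro h
  have hord := (hαβ.analyticOrderAt_eq (z := 1) (by simp)).2
  rw [h, analyticOrderAt_eq_top.2 (by simp)] at hord
  exact ENat.top_ne_natCast _ hord

theorem aeval_denom_eq_zero (hαβ : IsRHPZeroPoleList (sensitivity R τ) α β) (i : Fin M) :
    Polynomial.aeval (α i) R.denom = 0 := by
  refine apply_eq_zero_of_analyticOrderAt_ne_zero (𝕜 := ℂ)
    (f := fun s : ℂ => Polynomial.aeval s R.denom) ?_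
  rw [(hαβ.analyticOrderAt_eq (hαβ.1 i)).1, Nat.cast_ne_zero]
  exact Nat.card_ne_zero.2 ⟨⟨i, rfl⟩, inferInstance⟩

theorem closedLoopChar_eq_zero (hαβ : IsRHPZeroPoleList (sensitivity R τ) α β) (j : Fin N) :
    closedLoopChar R τ (β j) = 0 := by
  refine apply_eq_zero_of_analyticOrderAt_ne_zero (𝕜 := ℂ) ?_
  rw [(hαβ.analyticOrderAt_eq (hαβ.2.1 j)).2, Nat.cast_ne_zero]
  exact Nat.card_ne_zero.2 ⟨⟨j, rfl⟩, inferInstance⟩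

theorem pi_div_two_mul_log_norm_sub_blaschkeTerms_le (hτ : 0 ≤ τ)
    (hαβ : IsRHPZeroPoleList (sensitivity R τ) α β) {L S ωc : ℝ} (hLS : L ≤ S)
    (hin : ∀ s, s.re = 0 → |s.im| ≤ ωc → ‖sensitivity R τ s‖ ≤ Real.exp L)
    (hout : ∀ s, s.re = 0 → ωc < |s.im| → ‖sensitivity R τ s‖ ≤ Real.exp S)
    {σ : ℝ} (hσ : 0 < σ) (hσα : ∀ i, (σ : ℂ) ≠ α i) (hσβ : ∀ j, (σ : ℂ) ≠ β j) :
    Real.pi / 2 * (Real.log ‖sensitivity R τ σ‖ - blaschkeTerms α β σ) ≤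
      Real.arctan (ωc / σ) * L + (Real.pi / 2 - Real.arctan (ωc / σ)) * S := by
  have hbound : ∀ s, s.re = 0 → ‖sensitivity R τ s‖ ≤ Real.exp S := fun s hs =>
    (le_or_gt |s.im| ωc).elim (fun h => (hin s hs h).trans (Real.exp_le_exp.2 hLS)) (hout s hs)
  exact pi_div_two_mul_log_norm_div_sub_blaschkeTerms_le
    R.denom.differentiable_aeval (aeval_mem_polyGrowth R.denom)
    (differentiable_closedLoopChar R τ) (closedLoopChar_mem_polyGrowth R hτ) hαβ.1 hαβ.2.1
    (fun z hz => (hαβ.analyticOrderAt_eq hz).1) (fun z hz => (hαβ.analyticOrderAt_eq hz).2)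
    (fun s hs => ne_zero_on_axis_of_norm_div_le R.denom.differentiable_aeval.continuous
      (differentiable_closedLoopChar R τ) hαβ.closedLoopChar_ne_zero
      (fun s _ => aeval_denom_ne_zero_or_closedLoopChar_ne_zero R τ s) hbound hs)
    (one_isBigO_closedLoopChar R hτ hαβ.closedLoopChar_ne_zero) hLS hin hout hσ hσα hσβ

end IsRHPZeroPoleList

namespace IsNMPOpenLoopZero

variable {R : RatFunc ℝ} {ζ : ℂ}

theorem aeval_denom_ne_zero (hζ : IsNMPOpenLoopZero R ζ) : Polynomial.aeval ζ R.denom ≠ 0 :=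
  (Polynomial.aeval_ne_zero_of_isCoprime R.isCoprime_num_denom ζ).resolve_left (not_not.2 hζ.2)

theorem closedLoopChar_eq (hζ : IsNMPOpenLoopZero R ζ) (τ : ℝ) :
    closedLoopChar R τ ζ = Polynomial.aeval ζ R.denom := by
  rw [closedLoopChar, hζ.2, zero_mul, add_zero]

theorem sensitivity_eq_one (hζ : IsNMPOpenLoopZero R ζ) (τ : ℝ) : sensitivity R τ ζ = 1 := by
  rw [sensitivity_eq_aeval_denom_div, hζ.closedLoopChar_eq, div_self hζ.aeval_denom_ne_zero]

variable {τ : ℝ} {M N : ℕ} {α : Fin M → ℂ} {β : Fin N → ℂ}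

theorem ne_zero_of_sensitivity (hζ : IsNMPOpenLoopZero R ζ)
    (hαβ : IsRHPZeroPoleList (sensitivity R τ) α β) (i : Fin M) : ζ ≠ α i := fun h =>
  hζ.aeval_denom_ne_zero (h ▸ hαβ.aeval_denom_eq_zero i)

theorem ne_pole_of_sensitivity (hζ : IsNMPOpenLoopZero R ζ)
    (hαβ : IsRHPZeroPoleList (sensitivity R τ) α β) (j : Fin N) : ζ ≠ β j := fun h =>
  hζ.aeval_denom_ne_zero (hζ.closedLoopChar_eq τ ▸ h ▸ hαβ.closedLoopChar_eq_zero j)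

end IsNMPOpenLoopZero

theorem abs_div_le_of_neg_mul_le {c v θ l S : ℝ} (hc : 0 ≤ c) (hv : v ≤ 0) (hθ : 0 ≤ θ)
    (hθc : θ < c) (hl : l ≤ 0) (h : c * -v ≤ θ * l + (c - θ) * S) :
    |c * v + θ * l| / (c - θ) ≤ S := by
  have hsum : c * v + θ * l ≤ 0 :=
    add_nonpos (mul_nonpos_of_nonneg_of_nonpos hc hv) (mul_nonpos_of_nonneg_of_nonpos hθ hl)
  rw [abs_of_nonpos hsum, div_le_iff₀ (sub_pos.2 hθc)]
  linarith

end

theorem theorem2 (R : RatFunc ℝ) (τ : ℝ) (hτ : 0 ≤ τ)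
    {M N : ℕ} (α : Fin M → ℂ) (β : Fin N → ℂ)
    (hαβ : IsRHPZeroPoleList (sensitivity R τ) α β)
    (ωc ρ smax : ℝ) (hωc : 0 ≤ ωc)
    (hρ : IsGreatest ((fun ω : ℝ => ‖sensitivity R τ (Complex.I * ω)‖) '' Set.Icc 0 ωc) ρ)
    (hρ1 : ρ < 1)
    (hsmax : IsLUB ((fun ω : ℝ => ‖sensitivity R τ (Complex.I * ω)‖) '' Set.Ioi ωc) smax)
    (hsmax1 : 1 < smax) :
    (∀ σ : ℝ, 0 < σ → (∀ i, (σ : ℂ) ≠ α i) → (∀ j, (σ : ℂ) ≠ β j) →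
      -Real.log ‖sensitivity R τ σ‖ + blaschkeTerms α β σ ≤ 0 →
      |Real.pi / 2 * (-Real.log ‖sensitivity R τ σ‖ + blaschkeTerms α β σ)
          + Real.arctan (ωc / σ) * Real.log ρ| / (Real.pi / 2 - Real.arctan (ωc / σ))
        ≤ Real.log smax) ∧
    (∀ σ : ℝ, IsNMPOpenLoopZero R σ → blaschkeTerms α β σ ≤ 0 →
      |Real.pi / 2 * blaschkeTerms α β σ + Real.arctan (ωc / σ) * Real.log ρ|
          / (Real.pi / 2 - Real.arctan (ωc / σ))
        ≤ Real.log smax) := by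
  have hlogρ : Real.log ρ ≤ 0 := by
    obtain ⟨ω, -, hω⟩ := hρ.1
    exact Real.log_nonpos (hω ▸ norm_nonneg _) hρ1.le
  -- `ρ ≤ exp (log ρ)` also for `ρ = 0`, since `log 0 = 0`.
  have hin : ∀ s, s.re = 0 → |s.im| ≤ ωc → ‖sensitivity R τ s‖ ≤ Real.exp (Real.log ρ) :=
    fun s hs hsω => norm_sensitivity_I_mul_abs_im R τ hs ▸
      (hρ.2 ⟨|s.im|, ⟨abs_nonneg _, hsω⟩, rfl⟩).trans (Real.le_exp_log ρ)
  have hout : ∀ s, s.re = 0 → ωc < |s.im| → ‖sensitivity R τ s‖ ≤ Real.exp (Real.log smax) :=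
    fun s hs hsω => norm_sensitivity_I_mul_abs_im R τ hs ▸
      (hsmax.1 ⟨|s.im|, hsω, rfl⟩).trans (Real.le_exp_log smax)
  refine (and_iff_left_of_imp fun partA σ hσ hB => ?_).2 fun σ hσ hσα hσβ hv => ?_
  · simpa [hσ.sensitivity_eq_one] using partA σ hσ.1 (hσ.ne_zero_of_sensitivity hαβ)
      (hσ.ne_pole_of_sensitivity hαβ) (by simpa [hσ.sensitivity_eq_one] using hB)
  · have hpoisson := hαβ.pi_div_two_mul_log_norm_sub_blaschkeTerms_le hτ
      (hlogρ.trans (Real.log_pos hsmax1).le) hin hout hσ hσα hσβ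
    exact abs_div_le_of_neg_mul_le (by positivity) hv (Real.arctan_nonneg.2 (by positivity))
      (Real.arctan_lt_pi_div_two _) hlogρ (by rwa [neg_add', neg_neg])
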